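/- A weighted graph here is a finite simple graph $G=(V,E)$ with $V\neq\emptyset$ whose edges $e$ carry weights $\omega(e)>0$ (and $\omega(uv)=0$ if $uv\notin E$). The random walk on a connected weighted graph steps from $u$ to $v$ with probability $P_G(u,v)=\omega(uv)/\sum_{x}\omega(ux)$ (on the one-vertex graph, it stays in place). The hitting time $H_G(u,v)$ is the expected number of steps that the walk started at $u$ needs to reach $v$, the stationary distribution $\pi_G$ is the unique probability vector with $\pi_G^T=\pi_G^TP_G$, and Kemeny's constant is $\kappa(G)=\sum_{v\in V}H_G(u,v)\,\pi_G(v)$, where $u\in V$ is any starting vertex. Theorem. Let $W$ be a finite multiset of positive real numbers, and let $\mathcal{T}_W$ be the collection of all weighted trees whose edge weights form the multiset $W$. Let $S_W$ be the weighted star in $\mathcal{T}_W$: a centre joined to $|W|$ leaves by edges whose weights are the members of $W$. On $\mathcal{T}_W$ the constant $\kappa$ is well defined (the stationary distribution exists and is unique, $\kappa$ is finite and it does not depend on $u$). It attains its maximum on $\mathcal{T}_W$, and every element of $\mathcal{T}_W$ that maximizes $\kappa$ is a weighted path, i.e. its underlying graph is a path. An element of $\mathcal{T}_W$ minimizes $\kappa$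 if and only if it is isomorphic to $S_W$ as a weighted graph; that is, $S_W$ is, up to isomorphism, the unique minimizer. -/

import Mathlib

open scoped ENNReal

noncomputable section

/-- A finite nonempty weighted graph without loops: positive weights on the edges, and weight `0`
on all other pairs of vertices. -/
structure WeightedGraph : Type 1 where
  V : Type
  [fintype : Fintype V]
  [nonempty : Nonempty V]
  graph : SimpleGraph V
  weight : Sym2 V → ℝ
  weight_pos : ∀ e ∈ graph.edgeSet, 0 < weight e
  weight_zero : ∀ e ∉ graph.edgeSet, weight e = 0

namespace WeightedGraph

attribute [instance] WeightedGraph.fintype WeightedGraph.nonempty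

/-- The weighted degree of a vertex. -/
def degree (G : WeightedGraph) (u : G.V) : ℝ := ∑ v, G.weight s(u, v)

open Classical in
/-- Transition matrix of the random walk: the probability of stepping from `u` to `v` is
proportional to the weight of `uv`. (From an isolated vertex, which among connected graphs occurs
only in the one-vertex graph, the walk has nowhere to go and stays where it is.) -/
def transition (G : WeightedGraph) : Matrix G.V G.V ℝ := fun u v =>
  if G.degree u = 0 then (if u = v then 1 else 0) else G.weight s(u, v) / G.degree u

open Classical in
/-- The probability that the walk started at `u` is at `v` at time `n` and not earlier: the sum of
the probabilities of all trajectories `x 0, …, x n` with `x 0 = u` that reach `v` for the first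
time at time `n`. -/
def firstHitProb (G : WeightedGraph) (u v : G.V) (n : ℕ) : ℝ :=
  ∑ x : Fin (n + 1) → G.V with
      x 0 = u ∧ x (Fin.last n) = v ∧ ∀ i : Fin n, x i.castSucc ≠ v,
    ∏ i : Fin n, G.transition (x i.castSucc) (x i.succ)

/-- The hitting time `H(u, v)`: the expectation of the first time at which the walk started at `u`
is at `v`, with the value `∞` on the event that `v` is never reached. -/
def hittingTime (G : WeightedGraph) (u v : G.V) : ℝ≥0∞ :=
  ∑' n : ℕ, (n : ℝ≥0∞) * ENNReal.ofReal (G.firstHitProb u v n) +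
    ∞ * (1 - ∑' n : ℕ, ENNReal.ofReal (G.firstHitProb u v n))

/-- `π` is a probability vector with `πᵀ = πᵀ P`. -/
def IsStationary (G : WeightedGraph) (π : G.V → ℝ) : Prop :=
  π ∈ stdSimplex ℝ G.V ∧ Matrix.vecMul π G.transition = π

/-- The stationary distribution. -/
def stationary (G : WeightedGraph) : G.V → ℝ := Classical.epsilon G.IsStationary

/-- The expected time to travel from `u` to a random destination sampled from the stationary
distribution. -/
def kemenyFrom (G : WeightedGraph) (u : G.V) : ℝ≥0∞ :=
  ∑ v, G.hittingTime u v * ENNReal.ofReal (G.stationary v)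

/-- Kemeny's constant, computed from some fixed starting vertex. -/
def kemeny (G : WeightedGraph) : ℝ≥0∞ := G.kemenyFrom (Classical.arbitrary G.V)

open Classical in
/-- The multiset of the edge weights. -/
def edgeWeights (G : WeightedGraph) : Multiset ℝ := G.graph.edgeFinset.val.map G.weight

/-- The weighted trees whose edge weights form the multiset `W`. -/
def trees (W : Multiset ℝ) : Set WeightedGraph := {T | T.graph.IsTree ∧ T.edgeWeights = W}

/-- The underlying graph is a path. -/
def IsPath (G : WeightedGraph) : Prop :=
  ∃ n : ℕ, Nonempty (G.graph ≃g SimpleGraph.pathGraph n)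

/-- Isomorphism of weighted graphs. -/
def Isomorphic (G H : WeightedGraph) : Prop :=
  ∃ φ : G.graph ≃g H.graph, ∀ e : Sym2 G.V, H.weight (e.map φ) = G.weight e

open Classical in
/-- The weighted star `S_W`: a centre `none`, and for every member `i` of the multiset `W` (counted
with multiplicity) a leaf `some i`, joined to the centre by an edge whose weight is that member. -/
def star (W : Multiset ℝ) (hW : ∀ w ∈ W, 0 < w) : WeightedGraph where
  V := Option W
  graph := SimpleGraph.starGraph none
  weight := Sym2.lift ⟨fun a b => match a, b with
    | none, some i => i.1
    | some i, none => i.1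
    | _, _ => 0, by rintro (_ | _) (_ | _) <;> rfl⟩
  weight_pos := by
    intro e
    induction e using Sym2.ind with
    | _ a b =>
      intro h
      rw [SimpleGraph.mem_edgeSet, SimpleGraph.starGraph_adj] at h
      rcases a with _ | i <;> rcases b with _ | j
      · exact absurd rfl h.1
      · exact hW _ Multiset.coe_mem
      · exact hW _ Multiset.coe_mem
      · rcases h.2 with h | h <;> cases h
  weight_zero := by
    intro e
    induction e using Sym2.ind with
    | _ a b =>
      intro h
      rw [SimpleGraph.mem_edgeSet, SimpleGraph.starGraph_adj] at h
      rcases a with _ | i <;> rcases b with _ | j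
      · rfl
      · exact absurd ⟨by simp, Or.inl rfl⟩ h
      · exact absurd ⟨by simp, Or.inr rfl⟩ h
      · rfl

end WeightedGraph

end

/-!
For an edge `e` of a tree and a vertex `x`, let `D e x` (`cutDegree`) be the sum of the weighted
degrees of the vertices that stay connected to `x` when `e` is removed. On the way from `u` to `v`
the walk has to cross every edge `e` that separates them, and crossing `e` takes `D e u / ω e`
steps on average. The sum of these numbers (`treeHit`) is nonnegative, vanishes for `u = v`, and
solves the one-step equations, since the branches at `u` exhaust the other vertices
(`degree_add_sum_cutDegree`). By `hittingTime_eq`, which works with the survival probabilities of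
the walk, it is the hitting time. If there is more than
one vertex, pairing the one-step equations with a stationary vector `π` gives
`π v = degree v / totalDegree`, and exchanging sums yields `kemenyFrom_eq`: from any start,
Kemeny's constant is `cutSum / totalDegree`, where `cutSum` is the sum of
`D e a * D e b / ω e` over the edges `e = s(a, b)`. Here `D e a + D e b = totalDegree` is twice the
sum of the edge weights, so that only `cutSum` has to be compared.

*Minimum.* Since `D e a * D e b = ω e * (totalDegree - ω e) + (D e a - ω e) * (D e b - ω e)` and
both factors of the last product are nonnegative, `cutSum` is at least a constant depending on the
edge weights only, with equality if and only if each edge has an end with `D e a = ω e`, that is, an end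
that is a leaf (`cutDegree_eq_weight_iff`). A tree with this property is a star.

*Maximum.* `cutSum` takes only finitely many values on the trees with given edge weights
(`finite_cutSum`), so there is a maximizer. Suppose a vertex `v` has three neighbours `a`, `b`, `c`,
and the branch of `a` is at most as heavy as that of `b`. Replacing the edge `s(v, c)` by an edge
`s(a, c)` of the same weight (`slide`) leaves the terms of all edges other than `s(v, a)` unchanged
and makes the two factors of that term, whose sum is fixed, more equal. So `cutSum` increases
(`cutSum_lt_cutSum_slide`). Hence a maximizer has no vertex with three neighbours, and a longest
path in it is everything (`IsTree.exists_iso_pathGraph`).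
-/

open SimpleGraph

noncomputable section

/-! ### Hitting times and the one-step equations -/

namespace WeightedGraph

variable (G : WeightedGraph)

lemma weight_nonneg (e : Sym2 G.V) : 0 ≤ G.weight e := by
  by_cases h : e ∈ G.graph.edgeSet
  · exact (G.weight_pos e h).le
  · exact (G.weight_zero e h).ge

lemma weight_pos_of_adj {u v : G.V} (h : G.graph.Adj u v) : 0 < G.weight s(u, v) :=
  G.weight_pos _ h

lemma weight_of_not_adj {u v : G.V} (h : ¬ G.graph.Adj u v) : G.weight s(u, v) = 0 :=
  G.weight_zero _ h

lemma degree_nonneg (u : G.V) : 0 ≤ G.degree u :=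
  Finset.sum_nonneg fun _ _ => G.weight_nonneg _

lemma weight_le_degree (u v : G.V) : G.weight s(u, v) ≤ G.degree u :=
  Finset.single_le_sum (f := fun v => G.weight s(u, v)) (fun _ _ => G.weight_nonneg _)
    (Finset.mem_univ v)

lemma degree_pos_of_adj {u v : G.V} (h : G.graph.Adj u v) : 0 < G.degree u :=
  (G.weight_pos_of_adj h).trans_le (G.weight_le_degree u v)

lemma transition_nonneg (u v : G.V) : 0 ≤ G.transition u v := by
  unfold transition
  split_ifs
  · exact zero_le_one
  · exact le_rfl
  · exact div_nonneg (G.weight_nonneg _) (G.degree_nonneg _)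

lemma transition_of_degree_ne_zero {u : G.V} (h : G.degree u ≠ 0) (v : G.V) :
    G.transition u v = G.weight s(u, v) / G.degree u := by
  simp [transition, h]

open Classical in
lemma sum_transition (u : G.V) : ∑ v, G.transition u v = 1 := by
  by_cases h : G.degree u = 0
  · simp only [transition, h, if_true]
    exact (Finset.sum_ite_eq _ _ _).trans (if_pos (Finset.mem_univ u))
  · simp_rw [G.transition_of_degree_ne_zero h, ← Finset.sum_div]
    exact div_self h

lemma firstHitProb_nonneg (u v : G.V) (n : ℕ) : 0 ≤ G.firstHitProb u v n :=
  Finset.sum_nonneg fun _ _ => Finset.prod_nonneg fun _ _ => G.transition_nonneg _ _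

open Classical in
lemma firstHitProb_zero (u v : G.V) : G.firstHitProb u v 0 = if u = v then 1 else 0 := by
  unfold firstHitProb
  rw [Finset.sum_filter, ← (Equiv.funUnique (Fin 1) G.V).symm.sum_comp]
  simp [ite_and]

open Classical in
lemma firstHitProb_succ (u v : G.V) (n : ℕ) :
    G.firstHitProb u v (n + 1) =
      if u = v then 0 else ∑ w, G.transition u w * G.firstHitProb w v n := by
  have key : ∀ w, G.transition u w * G.firstHitProb w v n =
      ∑ y : Fin (n + 1) → G.V, if y 0 = w then
        (if y (Fin.last n) = v ∧ ∀ i : Fin n, y i.castSucc ≠ v then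
          G.transition u (y 0) * ∏ i : Fin n, G.transition (y i.castSucc) (y i.succ) else 0)
        else 0 := by
    intro w
    rw [firstHitProb, Finset.sum_filter, Finset.mul_sum]
    refine Finset.sum_congr rfl fun y _ => ?_
    by_cases h : y 0 = w
    · simp [h]
    · simp [h]
  simp_rw [key]
  rw [Finset.sum_comm]
  simp only [Finset.sum_ite_eq, Finset.mem_univ, if_true]
  rw [firstHitProb, Finset.sum_filter, ← (Fin.consEquiv fun _ => G.V).sum_comp,
    Fintype.sum_prod_type]
  simp only [Fin.consEquiv_apply, Fin.cons_zero, ite_and, Fin.forall_fin_succ, Fin.castSucc_zero,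
    Fin.prod_univ_succ, Fin.cons_succ, Fin.castSucc_succ, ← Fin.succ_last]
  rw [Finset.sum_eq_single u]
  · by_cases h : u = v
    · simp [h]
    · simp [h]
  · intro b _ hb
    simp [hb]
  · simp

/-- The probability that the walk started at `u` has not visited `v` up to time `n`. -/
def survival (v : G.V) (n : ℕ) (u : G.V) : ℝ := 1 - ∑ k ∈ Finset.range (n + 1), G.firstHitProb u v k

open Classical in
lemma survival_zero (u v : G.V) : G.survival v 0 u = if u = v then 0 else 1 := by
  simp only [survival, zero_add, Finset.sum_range_one, firstHitProb_zero]
  split_ifs <;> simp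

open Classical in
lemma survival_succ (u v : G.V) (n : ℕ) : G.survival v (n + 1) u =
    if u = v then 0 else ∑ w, G.transition u w * G.survival v n w := by
  rw [survival, Finset.sum_range_succ', firstHitProb_zero]
  simp_rw [firstHitProb_succ]
  split_ifs with h
  · simp
  · simp only [survival, mul_sub, Finset.sum_sub_distrib, mul_one, sum_transition]
    rw [Finset.sum_comm]
    simp [Finset.mul_sum]

lemma survival_nonneg (v : G.V) (n : ℕ) (u : G.V) : 0 ≤ G.survival v n u := by
  induction n generalizing u with
  | zero => rw [survival_zero]; split_ifs <;> simp
  | succ n ih =>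
    rw [survival_succ]
    split_ifs
    · exact le_rfl
    · exact Finset.sum_nonneg fun w _ => mul_nonneg (G.transition_nonneg _ _) (ih w)

lemma firstHitProb_eq_survival_sub (u v : G.V) (n : ℕ) :
    G.firstHitProb u v (n + 1) = G.survival v n u - G.survival v (n + 1) u := by
  simp [survival, Finset.sum_range_succ _ (n + 1)]

/-- Iterating the one-step equations `n` times. The remainder `r` is the expectation of `h` at the
position after `n` steps, on the event that `v` has not been visited. -/
lemma exists_remainder {v : G.V} {h : G.V → ℝ} (h0 : ∀ u, 0 ≤ h u) (hv : h v = 0)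
    (hstep : ∀ u, u ≠ v → h u = 1 + ∑ w, G.transition u w * h w) {B : ℝ} (hB : ∀ u, h u ≤ B)
    (n : ℕ) (u : G.V) :
    ∃ r, 0 ≤ r ∧ r ≤ B * G.survival v n u ∧
      h u = ∑ k ∈ Finset.range n, G.survival v k u + r := by
  classical
  induction n generalizing u with
  | zero =>
    refine ⟨h u, h0 u, ?_, by simp⟩
    rw [survival_zero]
    split_ifs with e
    · simp [e, hv]
    · simpa using hB u
  | succ n ih =>
    choose r hr0 hrB hr using ih
    by_cases e : u = v
    · refine ⟨0, le_rfl, by simp [survival_succ, e], ?_⟩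
      rw [Finset.sum_range_succ']
      simp [e, hv, survival_succ, survival_zero]
    · refine ⟨∑ w, G.transition u w * r w,
        Finset.sum_nonneg fun w _ => mul_nonneg (G.transition_nonneg _ _) (hr0 w), ?_, ?_⟩
      · rw [survival_succ, if_neg e, Finset.mul_sum]
        refine Finset.sum_le_sum fun w _ => ?_
        calc _ ≤ G.transition u w * (B * G.survival v n w) :=
              mul_le_mul_of_nonneg_left (hrB w) (G.transition_nonneg _ _)
          _ = _ := by ring
      · rw [Finset.sum_range_succ', hstep u e]
        simp_rw [survival_succ, if_neg e]
        rw [Finset.sum_comm, survival_zero, if_neg e]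
        have : ∀ w, G.transition u w * h w =
            ∑ k ∈ Finset.range n, G.transition u w * G.survival v k w
              + G.transition u w * r w := by
          intro w; rw [hr w, mul_add, Finset.mul_sum]
        simp_rw [this, Finset.sum_add_distrib]
        ring

/-- A nonnegative solution of the one-step equations for the expected time to reach `v` is the
hitting time; in particular the hitting time is then finite. -/
theorem hittingTime_eq {v : G.V} {h : G.V → ℝ} (h0 : ∀ u, 0 ≤ h u) (hv : h v = 0)
    (hstep : ∀ u, u ≠ v → h u = 1 + ∑ w, G.transition u w * h w) (u : G.V) :
    G.hittingTime u v = ENNReal.ofReal (h u) := by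
  obtain ⟨B, hB⟩ : ∃ B, ∀ u, h u ≤ B := by
    obtain ⟨B, hB⟩ := (Set.finite_range h).bddAbove
    exact ⟨B, fun u => hB ⟨u, rfl⟩⟩
  have hrem := fun n => G.exists_remainder h0 hv hstep hB n u
  set s := fun n => G.survival v n u with hs
  have s0 : ∀ n, 0 ≤ s n := fun n => G.survival_nonneg v n u
  have hsum : Summable s := by
    refine summable_of_sum_range_le (c := h u) s0 fun n => ?_
    obtain ⟨r, hr0, -, hr⟩ := hrem n
    linarith
  have slim : Filter.Tendsto s Filter.atTop (nhds 0) := hsum.tendsto_atTop_zero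
  have hS : HasSum s (h u) := by
    rw [hasSum_iff_tendsto_nat_of_nonneg s0]
    have lower : ∀ n, h u - B * s n ≤ ∑ k ∈ Finset.range n, s k := fun n => by
      obtain ⟨r, -, hr, hr'⟩ := hrem n
      linarith
    have upper : ∀ n, ∑ k ∈ Finset.range n, s k ≤ h u := fun n => by
      obtain ⟨r, hr, -, hr'⟩ := hrem n
      linarith
    refine tendsto_of_tendsto_of_tendsto_of_le_of_le ?_ tendsto_const_nhds lower upper
    simpa using (tendsto_const_nhds (x := h u)).sub (slim.const_mul B)
  have f0 := G.firstHitProb_nonneg u v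
  have tail : ∀ n, HasSum (fun k => G.firstHitProb u v (k + (n + 1))) (s n) := by
    intro n
    rw [hasSum_iff_tendsto_nat_of_nonneg fun k => f0 _]
    have : ∀ m, ∑ k ∈ Finset.range m, G.firstHitProb u v (k + (n + 1)) = s n - s (m + n) := by
      intro m
      induction m with
      | zero => simp
      | succ m ih =>
        rw [Finset.sum_range_succ, ih, ← add_assoc, firstHitProb_eq_survival_sub]
        simp only [hs]
        rw [add_right_comm m 1 n]
        ring
    simp_rw [this]
    simpa using (tendsto_const_nhds (x := s n)).sub ((Filter.tendsto_add_atTop_iff_nat n).2 slim)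
  have total : ∑' n, ENNReal.ofReal (G.firstHitProb u v n) = 1 := by
    have h1 := (tail 0).zero_add
    have : HasSum (G.firstHitProb u v) 1 := by
      have h2 : G.firstHitProb u v 0 + s 0 = 1 := by simp [hs, survival]
      rw [← h2]
      exact h1
    rw [← ENNReal.ofReal_tsum_of_nonneg f0 this.summable, this.tsum_eq, ENNReal.ofReal_one]
  -- the expectation is the sum of the tail probabilities
  have expect : ∑' n : ℕ, (n : ℝ≥0∞) * ENNReal.ofReal (G.firstHitProb u v n) =
      ENNReal.ofReal (h u) := by
    have e1 : ∀ n : ℕ, (n : ℝ≥0∞) * ENNReal.ofReal (G.firstHitProb u v n) =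
        ∑' k : ℕ, if k < n then ENNReal.ofReal (G.firstHitProb u v n) else 0 := by
      intro n
      rw [tsum_eq_sum (s := Finset.range n) (fun k hk => if_neg (by simpa using hk))]
      rw [Finset.sum_congr rfl fun k hk => if_pos (Finset.mem_range.1 hk)]
      simp
    have e2 : ∀ k : ℕ, (∑' n : ℕ, if k < n then ENNReal.ofReal (G.firstHitProb u v n) else 0) =
        ENNReal.ofReal (s k) := by
      intro k
      rw [← Summable.sum_add_tsum_nat_add' (k := k + 1) ENNReal.summable]
      rw [Finset.sum_eq_zero fun n hn => if_neg (by simp at hn; omega), zero_add]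
      rw [← (tail k).tsum_eq, ENNReal.ofReal_tsum_of_nonneg (fun _ => f0 _) (tail k).summable]
      exact tsum_congr fun n => if_pos (by omega)
    simp_rw [e1]
    rw [ENNReal.tsum_comm]
    simp_rw [e2]
    rw [← ENNReal.ofReal_tsum_of_nonneg s0 hsum, hS.tsum_eq]
  rw [hittingTime, total, expect]
  simp

end WeightedGraph

/-! ### The two sides of an edge of a tree -/

namespace SimpleGraph

variable {V : Type*} [Fintype V] {G : SimpleGraph V}

open Classical in
/-- The vertices on the side of `x` when the edge `e` is removed: those still reachable
from `x`. -/
def cutSide (G : SimpleGraph V) (e : Sym2 V) (x : V) : Finset V :=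
  {y | (G.deleteEdges {e}).Reachable x y}

lemma mem_cutSide {e : Sym2 V} {x y : V} :
    y ∈ G.cutSide e x ↔ (G.deleteEdges {e}).Reachable x y := by
  simp [cutSide]

lemma self_mem_cutSide (e : Sym2 V) (x : V) : x ∈ G.cutSide e x :=
  mem_cutSide.2 (Reachable.refl _)

lemma mem_cutSide_comm {e : Sym2 V} {x y : V} : y ∈ G.cutSide e x ↔ x ∈ G.cutSide e y := by
  simp only [mem_cutSide]
  exact reachable_comm

lemma cutSide_eq_of_mem {e : Sym2 V} {x y : V} (h : y ∈ G.cutSide e x) :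
    G.cutSide e y = G.cutSide e x := by
  ext z
  rw [mem_cutSide] at *
  rw [mem_cutSide]
  exact ⟨h.trans, h.symm.trans⟩

lemma mem_cutSide_of_adj {e : Sym2 V} {u w : V} (h : G.Adj u w) (he : s(u, w) ≠ e) :
    w ∈ G.cutSide e u := by
  rw [mem_cutSide]
  exact Adj.reachable (by simp [deleteEdges_adj, h, he])

lemma cutSide_eq_of_adj {e : Sym2 V} {u w : V} (h : G.Adj u w) (he : s(u, w) ≠ e) :
    G.cutSide e w = G.cutSide e u :=
  cutSide_eq_of_mem (mem_cutSide_of_adj h he)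

lemma IsAcyclic.notMem_cutSide (hG : G.IsAcyclic) {a b : V} (h : G.Adj a b) :
    b ∉ G.cutSide s(a, b) a := by
  rw [mem_cutSide]
  exact isBridge_iff.1 (isAcyclic_iff_forall_isBridge.1 hG h)

lemma Connected.mem_cutSide_or (hG : G.Connected) {a b : V} (x : V) :
    x ∈ G.cutSide s(a, b) a ∨ x ∈ G.cutSide s(a, b) b := by
  obtain ⟨p⟩ := hG.preconnected x a
  induction p with
  | nil => exact Or.inl (self_mem_cutSide _ _)
  | @cons u v w h p ih =>
    by_cases he : s(u, v) = s(w, b)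
    · rcases Sym2.eq_iff.1 he with ⟨rfl, -⟩ | ⟨rfl, -⟩
      · exact Or.inl (self_mem_cutSide _ _)
      · exact Or.inr (self_mem_cutSide _ _)
    · have := mem_cutSide_of_adj h.symm (Sym2.eq_swap.trans_ne he)
      refine ih.imp (fun hv => ?_) fun hv => ?_
      · rwa [← cutSide_eq_of_mem hv]
      · rwa [← cutSide_eq_of_mem hv]

lemma IsTree.mem_cutSide_iff (hG : G.IsTree) {a b : V} (h : G.Adj a b) (x : V) :
    x ∈ G.cutSide s(a, b) b ↔ x ∉ G.cutSide s(a, b) a := by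
  refine ⟨fun hb ha => hG.isAcyclic.notMem_cutSide h ?_,
    (hG.connected.mem_cutSide_or x).resolve_left⟩
  rw [← cutSide_eq_of_mem ha, cutSide_eq_of_mem hb]
  exact self_mem_cutSide _ _

/-- A set of vertices that is left only through the edge `s(a, b)` is one of its two sides. -/
lemma Connected.cutSide_eq (hG : G.Connected) {a b : V} {S : Finset V} (ha : a ∈ S)
    (hb : b ∉ S) (hS : ∀ u w, G.Adj u w → s(u, w) ≠ s(a, b) → u ∈ S → w ∈ S) :
    G.cutSide s(a, b) a = S := by
  have key : ∀ x y, (G.deleteEdges {s(a, b)}).Reachable x y → x ∈ S → y ∈ S := by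
    rintro x y ⟨p⟩
    induction p with
    | nil => exact id
    | cons h p ih =>
      rw [deleteEdges_adj] at h
      exact fun hx => ih (hS _ _ h.1 (by simpa using h.2) hx)
  ext x
  refine ⟨fun hx => key a x (mem_cutSide.1 hx) ha, fun hx => ?_⟩
  exact (hG.mem_cutSide_or x).resolve_right fun h => hb (key x b (mem_cutSide.1 h).symm hx)

/-- In a tree, exactly one of the edges at `u` separates `u` from a given other vertex. -/
lemma IsTree.existsUnique_notMem_cutSide (hG : G.IsTree) {u x : V} (h : u ≠ x) :
    ∃! w, G.Adj u w ∧ x ∉ G.cutSide s(u, w) u := by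
  classical
  obtain ⟨p, hp, -⟩ := hG.existsUnique_path u x
  cases p with
  | nil => exact absurd rfl h
  | @cons _ w _ hw q =>
    rw [Walk.cons_isPath_iff] at hp
    have avoid : ∀ y, s(u, y) ∉ q.edges := fun y hy => hp.2 (q.fst_mem_support_of_mem_edges hy)
    have far : ∀ y, x ∈ G.cutSide s(u, y) w := fun y => by
      rw [mem_cutSide, reachable_deleteEdges_iff_exists_walk]
      exact ⟨q, avoid y⟩
    refine ⟨w, ⟨hw, (hG.mem_cutSide_iff hw x).1 (far w)⟩, fun y hy => ?_⟩
    by_contra hne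
    refine hy.2 ?_
    rw [← cutSide_eq_of_adj hw (e := s(u, y)) (by simpa [Sym2.eq_iff, hw.ne'] using Ne.symm hne)]
    exact far y

end SimpleGraph

namespace WeightedGraph

variable (G : WeightedGraph)

/-- The sum of the weighted degrees on the side of `x` of the edge `e`. -/
def cutDegree (e : Sym2 G.V) (x : G.V) : ℝ := ∑ y ∈ G.graph.cutSide e x, G.degree y

/-- The sum of the weighted degrees of all vertices, that is, twice the total edge weight. -/
def totalDegree : ℝ := ∑ y, G.degree y

variable {G}

lemma cutDegree_nonneg (e : Sym2 G.V) (x : G.V) : 0 ≤ G.cutDegree e x :=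
  Finset.sum_nonneg fun y _ => G.degree_nonneg y

lemma cutDegree_add (hG : G.graph.IsTree) {a b : G.V} (h : G.graph.Adj a b) :
    G.cutDegree s(a, b) a + G.cutDegree s(a, b) b = G.totalDegree := by
  classical
  have : G.graph.cutSide s(a, b) b = (G.graph.cutSide s(a, b) a)ᶜ := by
    ext x; simp [hG.mem_cutSide_iff h]
  rw [cutDegree, cutDegree, this, Finset.sum_add_sum_compl, totalDegree]

lemma cutDegree_eq_of_mem {e : Sym2 G.V} {x y : G.V} (h : y ∈ G.graph.cutSide e x) :
    G.cutDegree e y = G.cutDegree e x := by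
  rw [cutDegree, cutDegree, cutSide_eq_of_mem h]

open Classical in
lemma cutDegree_eq_ite (hG : G.graph.IsTree) {a b : G.V} (h : G.graph.Adj a b) (x : G.V) :
    G.cutDegree s(a, b) x =
      if x ∈ G.graph.cutSide s(a, b) a then G.cutDegree s(a, b) a else G.cutDegree s(a, b) b := by
  split_ifs with hx
  · exact cutDegree_eq_of_mem hx
  · exact cutDegree_eq_of_mem ((hG.mem_cutSide_iff h x).2 hx)

open Classical in
/-- The branches at a vertex of a tree exhaust the other vertices. -/
lemma degree_add_sum_cutDegree (hG : G.graph.IsTree) (u : G.V) :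
    G.degree u + ∑ w with G.graph.Adj u w, G.cutDegree s(u, w) w = G.totalDegree := by
  have : ∀ w ∈ ({w | G.graph.Adj u w} : Finset G.V), G.cutDegree s(u, w) w =
      ∑ y, if y ∉ G.graph.cutSide s(u, w) u then G.degree y else 0 := by
    intro w hw
    rw [cutDegree, ← Finset.sum_filter]
    congr 1
    ext y
    simp [hG.mem_cutSide_iff (Finset.mem_filter.1 hw).2]
  rw [Finset.sum_congr rfl this, Finset.sum_comm, totalDegree, ← Finset.add_sum_erase _ _
    (Finset.mem_univ u), ← Finset.add_sum_erase Finset.univ _ (Finset.mem_univ u)]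
  have h0 : (∑ w with G.graph.Adj u w,
      if u ∉ G.graph.cutSide s(u, w) u then G.degree u else 0) = 0 :=
    Finset.sum_eq_zero fun w _ => if_neg (not_not.2 (self_mem_cutSide _ _))
  rw [h0, zero_add]
  congr 1
  refine Finset.sum_congr rfl fun y hy => ?_
  obtain ⟨w, ⟨hw, hwy⟩, huniq⟩ := hG.existsUnique_notMem_cutSide (Finset.ne_of_mem_erase hy).symm
  rw [Finset.sum_eq_single w]
  · exact if_pos hwy
  · intro b hb hbw
    exact if_neg fun hby => hbw (huniq b ⟨(Finset.mem_filter.1 hb).2, hby⟩)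
  · intro hw'
    simp [hw] at hw'

/-! ### Hitting times and the stationary distribution of a tree -/

open Classical in
/-- The hitting time of `v` from `u` in a tree: every edge `e` on the way from `u` to `v`
contributes the expected time to cross it, the weighted degrees on the side of `u` divided by the
weight of `e`. -/
def treeHit (G : WeightedGraph) (v u : G.V) : ℝ :=
  ∑ e ∈ G.graph.edgeFinset,
    if v ∈ G.graph.cutSide e u then 0 else G.cutDegree e u / G.weight e

lemma treeHit_nonneg (v u : G.V) : 0 ≤ G.treeHit v u := by
  refine Finset.sum_nonneg fun e _ => ?_
  split_ifs
  · exact le_rfl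
  · exact div_nonneg (cutDegree_nonneg _ _) (G.weight_nonneg _)

lemma treeHit_self (v : G.V) : G.treeHit v v = 0 :=
  Finset.sum_eq_zero fun _ _ => if_pos (self_mem_cutSide _ _)

open Classical in
/-- Across the edge `s(u, w)` only the term of that edge in `treeHit` changes. -/
lemma weight_mul_treeHit_sub (hG : G.graph.IsTree) (v : G.V) {u w : G.V} (h : G.graph.Adj u w) :
    G.weight s(u, w) * (G.treeHit v u - G.treeHit v w) =
      (if v ∉ G.graph.cutSide s(u, w) u then G.totalDegree else 0) - G.cutDegree s(u, w) w := by
  rw [treeHit, treeHit, ← Finset.sum_sub_distrib, Finset.sum_eq_single s(u, w)]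
  · rw [← cutDegree_add hG h]
    have := (G.weight_pos_of_adj h).ne'
    by_cases hv : v ∈ G.graph.cutSide s(u, w) u
    · simp [hG.mem_cutSide_iff h, hv]; field_simp
    · simp [hG.mem_cutSide_iff h, hv]; field_simp
  · intro e _ he
    rw [cutDegree, cutDegree, cutSide_eq_of_adj h he.symm, sub_self]
  · intro h'
    simp [h] at h'

open Classical in
/-- The Laplacian of `treeHit v` is the degree function, corrected at `v`. -/
lemma sum_weight_mul_treeHit_sub (hG : G.graph.IsTree) (v u : G.V) :
    ∑ w, G.weight s(u, w) * (G.treeHit v u - G.treeHit v w) =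
      G.degree u - if u = v then G.totalDegree else 0 := by
  have h1 : ∑ w, G.weight s(u, w) * (G.treeHit v u - G.treeHit v w) =
      ∑ w with G.graph.Adj u w, G.weight s(u, w) * (G.treeHit v u - G.treeHit v w) := by
    rw [Finset.sum_filter]
    refine Finset.sum_congr rfl fun w _ => ?_
    split_ifs with h
    · rfl
    · rw [G.weight_of_not_adj h, zero_mul]
  rw [h1, Finset.sum_congr rfl fun w hw =>
    weight_mul_treeHit_sub hG v (Finset.mem_filter.1 hw).2, Finset.sum_sub_distrib]
  have h2 : (∑ w with G.graph.Adj u w,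
      if v ∉ G.graph.cutSide s(u, w) u then G.totalDegree else 0) =
        if u = v then 0 else G.totalDegree := by
    split_ifs with huv
    · subst huv
      exact Finset.sum_eq_zero fun w _ => if_neg (not_not.2 (self_mem_cutSide _ _))
    · obtain ⟨w, ⟨hw, hwy⟩, huniq⟩ := hG.existsUnique_notMem_cutSide huv
      rw [Finset.sum_eq_single w]
      · exact if_pos hwy
      · intro b hb hbw
        exact if_neg fun hby => hbw (huniq b ⟨(Finset.mem_filter.1 hb).2, hby⟩)
      · intro hw'
        simp [hw] at hw'
  rw [h2, ← degree_add_sum_cutDegree hG u]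
  split_ifs <;> ring

lemma degree_pos [Nontrivial G.V] (hG : G.graph.Connected) (u : G.V) : 0 < G.degree u := by
  obtain ⟨w, hw⟩ := hG.preconnected.exists_adj_of_nontrivial u
  exact G.degree_pos_of_adj hw

lemma totalDegree_pos [Nontrivial G.V] (hG : G.graph.Connected) : 0 < G.totalDegree :=
  Finset.sum_pos (fun u _ => degree_pos hG u) Finset.univ_nonempty

open Classical in
lemma treeHit_sub_transition [Nontrivial G.V] (hG : G.graph.IsTree) (v u : G.V) :
    G.treeHit v u - ∑ w, G.transition u w * G.treeHit v w =
      1 - (if u = v then G.totalDegree else 0) / G.degree u := by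
  have hd := (degree_pos hG.connected u).ne'
  have : G.treeHit v u = ∑ w, G.transition u w * G.treeHit v u := by
    rw [← Finset.sum_mul, sum_transition, one_mul]
  rw [this, ← Finset.sum_sub_distrib, eq_sub_iff_add_eq, ← eq_sub_iff_add_eq]
  have h := sum_weight_mul_treeHit_sub hG v u
  simp_rw [transition_of_degree_ne_zero G hd]
  calc _ = (∑ w, G.weight s(u, w) * (G.treeHit v u - G.treeHit v w)) / G.degree u := by
        rw [Finset.sum_div]
        exact Finset.sum_congr rfl fun w _ => by ring
    _ = _ := by rw [h, sub_div, div_self hd]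

lemma hittingTime_eq_treeHit (hG : G.graph.IsTree) (u v : G.V) :
    G.hittingTime u v = ENNReal.ofReal (G.treeHit v u) := by
  refine G.hittingTime_eq (treeHit_nonneg v) (treeHit_self v) (fun u huv => ?_) u
  have : Nontrivial G.V := ⟨u, v, huv⟩
  have h := treeHit_sub_transition hG v u
  rw [if_neg huv, zero_div, sub_zero] at h
  linarith

lemma isStationary_degree_div [Nontrivial G.V] (hG : G.graph.Connected) :
    G.IsStationary fun v => G.degree v / G.totalDegree := by
  have ht := totalDegree_pos hG
  refine ⟨⟨fun v => div_nonneg (G.degree_nonneg v) ht.le, ?_⟩, funext fun v => ?_⟩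
  · rw [← Finset.sum_div]
    exact div_self ht.ne'
  · simp only [Matrix.vecMul, dotProduct]
    rw [degree, Finset.sum_div]
    refine Finset.sum_congr rfl fun u _ => ?_
    have hd := (degree_pos hG u).ne'
    rw [transition_of_degree_ne_zero G hd, Sym2.eq_swap (a := u)]
    field_simp

/-- Pairing a stationary `π` with the one-step equation of `treeHit v` determines `π v`. -/
lemma IsStationary.eq_degree_div [Nontrivial G.V] (hG : G.graph.IsTree) {π : G.V → ℝ}
    (hπ : G.IsStationary π) : π = fun v => G.degree v / G.totalDegree := by
  classical
  funext v
  have ht := (totalDegree_pos hG.connected).ne'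
  have hd := (degree_pos hG.connected v).ne'
  have h1 : ∑ u, π u * (G.treeHit v u - ∑ w, G.transition u w * G.treeHit v w) = 0 := by
    simp_rw [mul_sub, Finset.sum_sub_distrib, Finset.mul_sum, ← mul_assoc]
    rw [Finset.sum_comm]
    simp_rw [← Finset.sum_mul]
    rw [sub_eq_zero]
    refine Finset.sum_congr rfl fun w _ => ?_
    conv_lhs => rw [← hπ.2]
    rfl
  simp_rw [treeHit_sub_transition hG, mul_sub, mul_one, Finset.sum_sub_distrib, hπ.1.2] at h1
  rw [Finset.sum_eq_single v (fun u _ hu => by simp [hu]) (by simp)] at h1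
  rw [if_pos rfl] at h1
  field_simp at h1 ⊢
  linarith

lemma existsUnique_isStationary (hG : G.graph.IsTree) : ∃! π, G.IsStationary π := by
  rcases subsingleton_or_nontrivial G.V with hV | hV
  · have hone : ∀ f : G.V → ℝ, ∀ v, ∑ u, f u = f v := fun f v => by
      rw [Finset.sum_eq_single v (fun u _ h => (h (Subsingleton.elim _ _)).elim) (by simp)]
    refine ⟨fun _ => 1, ⟨⟨fun _ => zero_le_one, ?_⟩, funext fun v => ?_⟩, fun π hπ => ?_⟩
    · rw [hone _ (Classical.arbitrary G.V)]
    · simp only [Matrix.vecMul, dotProduct, one_mul]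
      rw [hone _ v, ← hone (fun w => G.transition v w) v, sum_transition]
    · funext v
      rw [← hone π v, hπ.1.2]
  · exact ⟨_, isStationary_degree_div hG.connected, fun π hπ => hπ.eq_degree_div hG⟩

lemma stationary_eq [Nontrivial G.V] (hG : G.graph.IsTree) (v : G.V) :
    G.stationary v = G.degree v / G.totalDegree := by
  have h : G.IsStationary G.stationary :=
    Classical.epsilon_spec (existsUnique_isStationary hG).exists
  exact congrFun (h.eq_degree_div hG) v

/-! ### Kemeny's constant of a tree -/

open Classical in
/-- Up to division by the total degree, Kemeny's constant of a tree: the sum over the edges `e` of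
the product of the degree sums on both sides of `e`, divided by the weight of `e`. The side that
is taken first is the one of `x`, which does not matter. -/
def cutSum (G : WeightedGraph) (x : G.V) : ℝ :=
  ∑ e ∈ G.graph.edgeFinset, G.cutDegree e x * (G.totalDegree - G.cutDegree e x) / G.weight e

lemma cutDegree_mul_sub (hG : G.graph.IsTree) {a b : G.V} (h : G.graph.Adj a b) (x : G.V) :
    G.cutDegree s(a, b) x * (G.totalDegree - G.cutDegree s(a, b) x) =
      G.cutDegree s(a, b) a * G.cutDegree s(a, b) b := by
  rw [← cutDegree_add hG h, cutDegree_eq_ite hG h x]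
  split_ifs <;> ring

lemma cutSum_eq (hG : G.graph.IsTree) (x y : G.V) : G.cutSum x = G.cutSum y := by
  classical
  refine Finset.sum_congr rfl fun e he => ?_
  induction e using Sym2.ind with
  | _ a b =>
    have h : G.graph.Adj a b := mem_edgeFinset.1 he
    rw [cutDegree_mul_sub hG h, cutDegree_mul_sub hG h]

/-- Kemeny's constant of a tree, from any starting vertex. On the one-vertex tree, where the total
degree is `0`, the right-hand side is `0` by the convention `0 / 0 = 0`, which is correct. -/
theorem kemenyFrom_eq (hG : G.graph.IsTree) (u x : G.V) :
    G.kemenyFrom u = ENNReal.ofReal (G.cutSum x / G.totalDegree) := by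
  classical
  rw [kemenyFrom]
  rcases subsingleton_or_nontrivial G.V with hV | hV
  · have h0 : G.cutSum x = 0 := Finset.sum_eq_zero fun e he => by
      induction e using Sym2.ind with
      | _ a b =>
        have h : G.graph.Adj a b := mem_edgeFinset.1 he
        exact absurd (Subsingleton.elim a b) h.ne
    rw [h0, zero_div, ENNReal.ofReal_zero]
    refine Finset.sum_eq_zero fun v _ => ?_
    rw [hittingTime_eq_treeHit hG, Subsingleton.elim u v, treeHit_self]
    simp
  · have ht := totalDegree_pos hG.connected
    have : ∀ v, G.hittingTime u v * ENNReal.ofReal (G.stationary v) =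
        ENNReal.ofReal (G.treeHit v u * (G.degree v / G.totalDegree)) := fun v => by
      rw [hittingTime_eq_treeHit hG, stationary_eq hG, ENNReal.ofReal_mul (treeHit_nonneg _ _)]
    simp_rw [this]
    rw [← ENNReal.ofReal_sum_of_nonneg fun v _ => mul_nonneg (treeHit_nonneg _ _)
      (div_nonneg (G.degree_nonneg v) ht.le), cutSum_eq hG x u]
    congr 1
    simp_rw [← mul_div_assoc, ← Finset.sum_div]
    congr 1
    simp_rw [treeHit, Finset.sum_mul]
    rw [Finset.sum_comm]
    refine Finset.sum_congr rfl fun e _ => ?_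
    have hcompl : G.totalDegree - G.cutDegree e u =
        ∑ v, if v ∈ G.graph.cutSide e u then 0 else G.degree v := by
      rw [sub_eq_iff_eq_add, totalDegree, cutDegree, ← Finset.sum_filter_add_sum_filter_not
        Finset.univ (· ∈ G.graph.cutSide e u), add_comm]
      congr 1
      · rw [Finset.sum_filter]
        simp
      · simp
    rw [hcompl, mul_div_right_comm, Finset.mul_sum]
    exact Finset.sum_congr rfl fun v _ => by split_ifs <;> simp

end WeightedGraph

/-! ### Multisets of values -/

namespace Multiset

/-- A family indexed by a finite type can be reindexed by the multiset of its values. -/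
lemma exists_equiv_toType {α ι : Type*} [DecidableEq α] [Fintype ι] {W : Multiset α} (f : ι → α)
    (h : Finset.univ.val.map f = W) : ∃ e : ι ≃ W, ∀ i, (e i).1 = f i := by
  classical
  have hcard : ∀ a, Fintype.card {i // f i = a} = W.count a := fun a => by
    rw [← h, count_map, Fintype.card_subtype, Finset.card_def, Finset.filter_val]
    simp only [eq_comm]
  refine ⟨(Equiv.sigmaFiberEquiv f).symm.trans
    (Equiv.sigmaCongrRight fun a => Fintype.equivFinOfCardEq (hcard a)), fun i => rfl⟩

/-- The sums of `n` elements, with repetition, of a finite set. -/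
lemma finite_sums (F : Set ℝ) (hF : F.Finite) (n : ℕ) :
    {x : ℝ | ∃ m : Multiset ℝ, (∀ a ∈ m, a ∈ F) ∧ m.card = n ∧ m.sum = x}.Finite := by
  induction n with
  | zero =>
    refine (Set.finite_singleton 0).subset ?_
    rintro x ⟨m, -, hm, rfl⟩
    simp [card_eq_zero.1 hm]
  | succ n ih =>
    refine (Set.Finite.image2 (· + ·) hF ih).subset ?_
    rintro x ⟨m, hmF, hm, rfl⟩
    obtain ⟨a, ha⟩ := card_pos_iff_exists_mem.1 (by omega : 0 < m.card)
    obtain ⟨m, rfl⟩ := exists_cons_of_mem ha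
    refine ⟨a, hmF a (mem_cons_self _ _), m.sum,
      ⟨m, fun b hb => hmF b (mem_cons_of_mem hb), by simpa using hm, rfl⟩, by simp⟩

end Multiset

/-! ### Recognizing stars and paths -/

namespace SimpleGraph

variable {V : Type*} {G : SimpleGraph V}

/-- A connected graph in which one end of each edge is a leaf is a star. -/
lemma Connected.exists_eq_starGraph (hG : G.Connected)
    (h : ∀ a b, G.Adj a b → (∀ y, G.Adj a y → y = b) ∨ ∀ y, G.Adj b y → y = a) :
    ∃ c, G = starGraph c := by
  by_cases hE : ∃ a b, G.Adj a b ∧ ∀ y, G.Adj a y → y = b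
  · obtain ⟨a, c, hac, ha⟩ := hE
    have near : ∀ x, x = c ∨ G.Adj x c := by
      intro x
      obtain ⟨p⟩ := hG.preconnected x c
      induction p with
      | nil => exact Or.inl rfl
      | @cons x y c hxy p ih =>
        rcases ih hac ha with rfl | hy
        · exact Or.inr hxy
        · rcases h y c hy with hy' | hc
          · exact Or.inl (hy' x hxy.symm)
          · obtain rfl := hc a hac.symm
            exact Or.inl (ha x hxy.symm)
    refine ⟨c, ?_⟩
    ext x y
    rw [starGraph_adj]
    refine ⟨fun hxy => ⟨hxy.ne, ?_⟩, ?_⟩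
    · by_contra! hne
      have hx := (near x).resolve_left hne.1
      rcases h x c hx with hx' | hc
      · exact hne.2 (hx' y hxy)
      · exact hxy.ne (hc y ((near y).resolve_left hne.2).symm).symm
    · rintro ⟨hne, rfl | rfl⟩
      · exact ((near y).resolve_left hne.symm).symm
      · exact (near x).resolve_left hne
  · push Not at hE
    obtain ⟨c⟩ := hG.nonempty
    have : ∀ a b, ¬ G.Adj a b := by
      intro a b hab
      obtain ⟨y, hy, hyb⟩ := hE a b hab
      obtain ⟨z, hz, hza⟩ := hE b a hab.symm
      rcases h a b hab with h' | h'
      · exact hyb (h' y hy)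
      · exact hza (h' z hz)
    refine ⟨c, ?_⟩
    have all : ∀ x, x = c := by
      intro x
      obtain ⟨p⟩ := hG.preconnected x c
      cases p with
      | nil => rfl
      | cons hxy _ => exact absurd hxy (this _ _)
    ext x y
    rw [starGraph_adj, all x, all y]
    simp

lemma starGraph_adj_leaf (c : V) {a b : V} (h : (starGraph c).Adj a b) :
    (∀ y, (starGraph c).Adj a y → y = b) ∨ ∀ y, (starGraph c).Adj b y → y = a := by
  simp only [starGraph_adj] at *
  grind

/-- A longest path cannot be extended at its start. -/
lemma IsAcyclic.toSubgraph_adj_start (hG : G.IsAcyclic) {u v y : V} {p : G.Walk u v}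
    (hp : p.IsPath)
    (hmax : ∀ (u' v' : V) (p' : G.Walk u' v'), p'.IsPath → p'.length ≤ p.length)
    (h : G.Adj u y) : p.toSubgraph.Adj u y := by
  by_cases hy : y ∈ p.support
  · have := hG.eq_snd_of_adj_start hp h hy
    subst this
    refine p.toSubgraph_adj_snd fun hnil => ?_
    cases hnil
    exact h.ne rfl
  · have := hmax _ _ _ (hp.cons (h := h.symm) hy)
    simp at this

/-- A finite tree without a vertex that has three neighbours is a path. -/
lemma IsTree.exists_iso_pathGraph [Finite V] (hG : G.IsTree)
    (h : ∀ v a b c, G.Adj v a → G.Adj v b → G.Adj v c → a = b ∨ a = c ∨ b = c) :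
    ∃ n : ℕ, Nonempty (G ≃g pathGraph n) := by
  classical
  have := hG.connected.nonempty
  obtain ⟨u, v, p, hp, hmax⟩ := Walk.exists_isPath_forall_isPath_length_le_length G
  have key : ∀ x ∈ p.support, ∀ y, G.Adj x y → p.toSubgraph.Adj x y := by
    intro x hx y hxy
    obtain ⟨i, rfl, hi⟩ := Walk.mem_support_iff_exists_getVert.1 hx
    rcases Nat.eq_zero_or_pos i with rfl | hi0
    · rw [Walk.getVert_zero] at hxy ⊢
      exact hG.isAcyclic.toSubgraph_adj_start hp hmax hxy
    rcases hi.eq_or_lt with rfl | hil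
    · rw [Walk.getVert_length] at hxy ⊢
      rw [← Walk.toSubgraph_reverse]
      exact hG.isAcyclic.toSubgraph_adj_start hp.reverse (by simpa using hmax) hxy
    · obtain ⟨j, rfl⟩ : ∃ j, i = j + 1 := ⟨i - 1, by omega⟩
      have h1 := p.toSubgraph_adj_getVert (i := j) (by omega)
      have h2 := p.toSubgraph_adj_getVert hil
      rcases h _ _ _ _ h1.symm.adj_sub h2.adj_sub hxy with e | e | e
      · have := hp.getVert_injOn (by simp; omega) (by simp; omega) e
        omega
      · exact e ▸ h1.symm
      · exact e ▸ h2
  have hsupp : ∀ x, x ∈ p.support := by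
    intro x
    obtain ⟨q⟩ := hG.connected.preconnected x u
    induction q with
    | nil => exact p.start_mem_support
    | @cons x y _ hxy q ih =>
      exact p.mem_verts_toSubgraph.1 (key y (ih p hp hmax key) x hxy.symm).snd_mem
  have htop : p.toSubgraph = ⊤ := by
    ext x y
    · simp [hsupp]
    · exact ⟨fun h => h.adj_sub, key x (hsupp x) y⟩
  have e := hp.pathGraphIsoToSubgraph
  rw [htop] at e
  exact ⟨_, ⟨(e.trans Subgraph.topIso).symm⟩⟩

end SimpleGraph

namespace WeightedGraph

variable {G : WeightedGraph} {W : Multiset ℝ}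

/-! ### Comparing trees with the same edge weights -/

lemma totalDegree_eq (G : WeightedGraph) : G.totalDegree = 2 * G.edgeWeights.sum := by
  classical
  have h1 : G.totalDegree = ∑ p : G.V × G.V with G.graph.Adj p.1 p.2, G.weight s(p.1, p.2) := by
    rw [Finset.sum_filter, Fintype.sum_prod_type]
    refine Finset.sum_congr rfl fun u _ => Finset.sum_congr rfl fun v _ => ?_
    split_ifs with h
    · rfl
    · exact G.weight_of_not_adj h
  rw [h1, edgeWeights, ← Finset.sum_eq_multiset_sum, Finset.mul_sum]
  rw [← Finset.sum_fiberwise_of_maps_to (t := G.graph.edgeFinset)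
    (g := fun p : G.V × G.V => s(p.1, p.2)) (by simp)]
  refine Finset.sum_congr rfl fun e he => ?_
  induction e using Sym2.ind with
  | _ a b =>
    have h : G.graph.Adj a b := mem_edgeFinset.1 he
    have : ({p ∈ ({p | G.graph.Adj p.1 p.2} : Finset (G.V × G.V)) | s(p.1, p.2) = s(a, b)}) =
        {(a, b), (b, a)} := by
      ext ⟨x, y⟩
      simp only [Finset.mem_filter, Finset.mem_univ, true_and, Sym2.eq_iff, Finset.mem_insert,
        Finset.mem_singleton, Prod.mk.injEq]
      constructor
      · rintro ⟨-, h'⟩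
        exact h'
      · rintro (⟨rfl, rfl⟩ | ⟨rfl, rfl⟩)
        · exact ⟨h, Or.inl ⟨rfl, rfl⟩⟩
        · exact ⟨h.symm, Or.inr ⟨rfl, rfl⟩⟩
    rw [this, Finset.sum_pair (by simp [h.ne]), Sym2.eq_swap (a := b)]
    ring

lemma totalDegree_of_mem_trees (h : G ∈ trees W) : G.totalDegree = 2 * W.sum := by
  rw [totalDegree_eq, h.2]

/-- On the trees with given edge weights, Kemeny's constant and `cutSum` are ordered alike. -/
lemma kemeny_le_kemeny_iff {T T' : WeightedGraph} (hT : T ∈ trees W) (hT' : T' ∈ trees W)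
    (x : T.V) (y : T'.V) : T.kemeny ≤ T'.kemeny ↔ T.cutSum x ≤ T'.cutSum y := by
  classical
  have nonneg : ∀ {G : WeightedGraph} (x : G.V), 0 ≤ G.cutSum x := fun {G} x =>
    Finset.sum_nonneg fun e _ => div_nonneg (mul_nonneg (cutDegree_nonneg _ _) (sub_nonneg.2
      (Finset.sum_le_sum_of_subset_of_nonneg (Finset.subset_univ _) fun y _ _ =>
        G.degree_nonneg y))) (G.weight_nonneg _)
  have ht : 0 ≤ 2 * W.sum := by
    rw [← totalDegree_of_mem_trees hT]
    exact Finset.sum_nonneg fun y _ => T.degree_nonneg y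
  rw [kemeny, kemeny, kemenyFrom_eq hT.1 _ x, kemenyFrom_eq hT'.1 _ y,
    totalDegree_of_mem_trees hT, totalDegree_of_mem_trees hT',
    ENNReal.ofReal_le_ofReal_iff (div_nonneg (nonneg _) ht)]
  rcases ht.eq_or_lt with h0 | h0
  · -- only the one-vertex tree has total weight zero
    have zero : ∀ {G : WeightedGraph} (x : G.V), G ∈ trees W → G.cutSum x = 0 := by
      intro G x hG
      refine Finset.sum_eq_zero fun e he => ?_
      induction e using Sym2.ind with
      | _ a b =>
        have h : G.graph.Adj a b := mem_edgeFinset.1 he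
        have := (G.degree_pos_of_adj h).trans_le (Finset.single_le_sum
          (fun y _ => G.degree_nonneg y) (Finset.mem_univ a))
        have h2 := totalDegree_of_mem_trees hG
        rw [totalDegree, ← h0] at h2
        exact absurd h2 this.ne'
    simp [zero x hT, zero y hT']
  · exact div_le_div_iff_of_pos_right h0

/-! ### The minimizer is the star -/

lemma degree_le_cutDegree (e : Sym2 G.V) (x : G.V) : G.degree x ≤ G.cutDegree e x :=
  Finset.single_le_sum (f := G.degree) (fun y _ => G.degree_nonneg y) (self_mem_cutSide e x)

lemma weight_le_cutDegree (a b : G.V) : G.weight s(a, b) ≤ G.cutDegree s(a, b) a :=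
  (G.weight_le_degree a b).trans (degree_le_cutDegree _ _)

lemma degree_eq_of_leaf {a b : G.V} (h : ∀ y, G.graph.Adj a y → y = b) :
    G.degree a = G.weight s(a, b) :=
  Finset.sum_eq_single b (fun y _ hy => G.weight_of_not_adj fun hay => hy (h y hay)) (by simp)

/-- The weighted degrees on one side of an edge sum up to the weight of the edge if and only if
that side is a leaf. -/
lemma cutDegree_eq_weight_iff (hG : G.graph.IsTree) {a b : G.V} (h : G.graph.Adj a b) :
    G.cutDegree s(a, b) a = G.weight s(a, b) ↔ ∀ y, G.graph.Adj a y → y = b := by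
  classical
  refine ⟨fun heq y hy => ?_, fun hleaf => ?_⟩
  · by_contra hne
    have h1 : G.weight s(a, y) + G.weight s(a, b) ≤ G.degree a := by
      rw [← Finset.sum_pair (f := fun y => G.weight s(a, y)) hne]
      exact Finset.sum_le_sum_of_subset_of_nonneg (Finset.subset_univ _)
        fun _ _ _ => G.weight_nonneg _
    have h2 := degree_le_cutDegree s(a, b) a
    have h3 := G.weight_pos_of_adj hy
    linarith
  · have : G.graph.cutSide s(a, b) a = {a} := by
      refine hG.connected.cutSide_eq (Finset.mem_singleton_self a) (by simpa using h.ne')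
        fun u w huw hne hu => ?_
      obtain rfl := Finset.mem_singleton.1 hu
      exact absurd (by rw [hleaf w huw]) hne
    rw [cutDegree, this, Finset.sum_singleton, degree_eq_of_leaf hleaf]

/-- The smallest possible value of `cutSum`, given the edge weights. -/
def minCutSum (W : Multiset ℝ) : ℝ := (W.map fun w => 2 * W.sum - w).sum

open Classical in
/-- The deviation of `cutSum` from its smallest value, as a sum of nonnegative terms. -/
lemma cutSum_eq_add (hG : G ∈ trees W) (x : G.V) :
    G.cutSum x = minCutSum W + ∑ e ∈ G.graph.edgeFinset,
      (G.cutDegree e x - G.weight e) * (2 * W.sum - G.cutDegree e x - G.weight e) /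
        G.weight e := by
  have h1 : minCutSum W = ∑ e ∈ G.graph.edgeFinset, (2 * W.sum - G.weight e) := by
    rw [minCutSum]
    conv_lhs => enter [1, 2]; rw [← hG.2]
    rw [edgeWeights, Multiset.map_map]
    rfl
  rw [h1, ← Finset.sum_add_distrib, cutSum]
  refine Finset.sum_congr rfl fun e he => ?_
  have := (G.weight_pos e (mem_edgeFinset.1 he)).ne'
  rw [totalDegree_of_mem_trees hG]
  field_simp
  ring

lemma cutTerm_eq (hG : G ∈ trees W) {a b : G.V} (h : G.graph.Adj a b) (x : G.V) :
    (G.cutDegree s(a, b) x - G.weight s(a, b)) *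
        (2 * W.sum - G.cutDegree s(a, b) x - G.weight s(a, b)) =
      (G.cutDegree s(a, b) a - G.weight s(a, b)) *
        (G.cutDegree s(a, b) b - G.weight s(a, b)) := by
  rw [← totalDegree_of_mem_trees hG, ← cutDegree_add hG.1 h, cutDegree_eq_ite hG.1 h x]
  split_ifs <;> ring

lemma cutTerm_nonneg (hG : G ∈ trees W) (x : G.V) {e : Sym2 G.V} (he : e ∈ G.graph.edgeSet) :
    0 ≤ (G.cutDegree e x - G.weight e) * (2 * W.sum - G.cutDegree e x - G.weight e) /
      G.weight e := by
  refine div_nonneg ?_ (G.weight_nonneg e)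
  induction e using Sym2.ind with
  | _ a b =>
    rw [cutTerm_eq hG he]
    refine mul_nonneg (sub_nonneg.2 (weight_le_cutDegree a b)) (sub_nonneg.2 ?_)
    rw [Sym2.eq_swap]
    exact weight_le_cutDegree b a

lemma minCutSum_le (hG : G ∈ trees W) (x : G.V) : minCutSum W ≤ G.cutSum x := by
  classical
  rw [cutSum_eq_add hG x]
  exact le_add_of_nonneg_right (Finset.sum_nonneg fun e he =>
    cutTerm_nonneg hG x (mem_edgeFinset.1 he))

lemma cutSum_eq_minCutSum_iff (hG : G ∈ trees W) (x : G.V) :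
    G.cutSum x = minCutSum W ↔ ∃ c, G.graph = starGraph c := by
  classical
  rw [cutSum_eq_add hG x, add_eq_left, Finset.sum_eq_zero_iff_of_nonneg fun e he =>
    cutTerm_nonneg hG x (mem_edgeFinset.1 he)]
  have key : ∀ a b, G.graph.Adj a b → (((G.cutDegree s(a, b) x - G.weight s(a, b)) *
      (2 * W.sum - G.cutDegree s(a, b) x - G.weight s(a, b)) / G.weight s(a, b) = 0) ↔
      ((∀ y, G.graph.Adj a y → y = b) ∨ ∀ y, G.graph.Adj b y → y = a)) := by
    intro a b h
    rw [cutTerm_eq hG h, div_eq_zero_iff, or_iff_left (G.weight_pos_of_adj h).ne', mul_eq_zero,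
      sub_eq_zero, sub_eq_zero, cutDegree_eq_weight_iff hG.1 h, Sym2.eq_swap (a := a),
      cutDegree_eq_weight_iff hG.1 h.symm]
  constructor
  · intro h
    exact hG.1.connected.exists_eq_starGraph fun a b hab =>
      (key a b hab).1 (h _ (mem_edgeFinset.2 hab))
  · rintro ⟨c, hc⟩ e he
    induction e using Sym2.ind with
    | _ a b =>
      have hab : G.graph.Adj a b := mem_edgeFinset.1 he
      rw [key a b hab]
      rw [hc] at hab ⊢
      exact starGraph_adj_leaf c hab

open Classical in
lemma edgeWeights_of_starGraph {c : G.V} (hc : G.graph = starGraph c) :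
    G.edgeWeights = (Finset.univ : Finset {x // x ≠ c}).val.map
      fun x : {x // x ≠ c} => G.weight s(c, x) := by
  have : G.graph.edgeFinset = (Finset.univ : Finset {x // x ≠ c}).map
      ⟨fun x => s(c, x.1), fun x y h => Subtype.ext (Sym2.congr_right.1 h)⟩ := by
    ext e
    induction e using Sym2.ind with
    | _ a b =>
      rw [mem_edgeFinset, mem_edgeSet, hc, starGraph_adj]
      rw [Finset.mem_map]
      constructor
      · rintro ⟨hne, rfl | rfl⟩
        · exact ⟨⟨b, hne.symm⟩, Finset.mem_univ _, rfl⟩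
        · exact ⟨⟨a, hne⟩, Finset.mem_univ _, Sym2.eq_swap⟩
      · rintro ⟨x, -, hx⟩
        rcases Sym2.eq_iff.1 hx with ⟨rfl, h⟩ | ⟨rfl, h⟩
        · exact ⟨fun h' => x.2 (h.trans h'.symm), Or.inl rfl⟩
        · exact ⟨fun h' => x.2 (h.trans h'), Or.inr rfl⟩
  rw [edgeWeights, this, Finset.map_val, Multiset.map_map]
  rfl

/-- A weighted star is isomorphic to the standard one with the same edge weights. -/
lemma isomorphic_star (hW : ∀ w ∈ W, 0 < w) (hG : G.edgeWeights = W) {c : G.V}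
    (hc : G.graph = starGraph c) : G.Isomorphic (star W hW) := by
  classical
  obtain ⟨e, he⟩ := Multiset.exists_equiv_toType (fun x : {x // x ≠ c} => G.weight s(c, x))
    ((edgeWeights_of_starGraph hc).symm.trans hG)
  let ψ : G.V ≃ Option W := (Equiv.optionSubtypeNe c).symm.trans (Equiv.optionCongr e)
  have hψc : ψ c = none := by simp [ψ]
  have hψ : ∀ x, ψ x = none ↔ x = c := fun x => by rw [← hψc, ψ.apply_eq_iff_eq]
  have hψw : ∀ x (hx : x ≠ c), ψ x = some (e ⟨x, hx⟩) := fun x hx => by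
    simp [ψ, Equiv.optionSubtypeNe_symm_of_ne hx]
  refine ⟨⟨ψ, fun {a b} => ?_⟩, fun s => ?_⟩
  · rw [hc]
    change (starGraph (none : Option W)).Adj (ψ a) (ψ b) ↔ _
    simp only [starGraph_adj, hψ, ne_eq, ψ.apply_eq_iff_eq]
  · induction s using Sym2.ind with
    | _ a b =>
      change (star W hW).weight s(ψ a, ψ b) = _
      by_cases ha : a = c
      · subst ha
        by_cases hb : b = a
        · subst hb
          rw [hψc]
          exact (G.weight_of_not_adj (G.graph.irrefl)).symm
        · rw [hψc, hψw b hb]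
          exact he _
      · by_cases hb : b = c
        · subst hb
          rw [hψc, hψw a ha, Sym2.eq_swap (a := a)]
          exact he _
        · rw [hψw a ha, hψw b hb, G.weight_of_not_adj]
          · rfl
          · rw [hc, starGraph_adj]
            simp [ha, hb]

lemma star_mem_trees (hW : ∀ w ∈ W, 0 < w) : star W hW ∈ trees W := by
  classical
  refine ⟨isTree_starGraph _, ?_⟩
  rw [edgeWeights_of_starGraph (G := star W hW) (c := (none : Option W)) rfl]
  conv_rhs => rw [← W.map_univ_coe]
  let φ : W ≃ {x : (star W hW).V // x ≠ (none : Option W)} :=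
    ⟨fun i => ⟨(some i : Option W), Option.some_ne_none i⟩,
      fun x => Option.get x.1 (Option.ne_none_iff_isSome.1 x.2),
      fun i => rfl, fun x => Subtype.ext (Option.some_get _)⟩
  have := Multiset.map_univ_val_equiv φ
  refine (congrArg (Multiset.map _) this.symm).trans ?_
  rw [Multiset.map_map]
  rfl

theorem isMinOn_kemeny_iff (hW : ∀ w ∈ W, 0 < w) {T : WeightedGraph} (hT : T ∈ trees W) :
    IsMinOn kemeny (trees W) T ↔ T.Isomorphic (star W hW) := by
  have hS := star_mem_trees hW
  have x := Classical.arbitrary T.V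
  have hmin : (star W hW).cutSum (none : Option W) = minCutSum W :=
    (cutSum_eq_minCutSum_iff hS _).2 ⟨_, rfl⟩
  constructor
  · intro h
    have h1 := (kemeny_le_kemeny_iff hT hS x (none : Option W)).1 (h hS)
    rw [hmin] at h1
    obtain ⟨c, hc⟩ := (cutSum_eq_minCutSum_iff hT x).1 (h1.antisymm (minCutSum_le hT x))
    exact isomorphic_star hW hT.2 hc
  · rintro ⟨φ, -⟩ T' hT'
    refine (kemeny_le_kemeny_iff hT hT' x (Classical.arbitrary T'.V)).2 ?_
    refine ((cutSum_eq_minCutSum_iff hT x).2 ⟨φ.symm (none : Option W), ?_⟩).trans_le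
      (minCutSum_le hT' _)
    ext a b
    have hn : ∀ y, φ y = (none : Option W) ↔ y = φ.symm (none : Option W) :=
      fun y => φ.toEquiv.eq_symm_apply.symm
    have e : T.graph.Adj a b ↔
        φ a ≠ φ b ∧ (φ a = (none : Option W) ∨ φ b = (none : Option W)) :=
      φ.map_adj_iff.symm.trans starGraph_adj
    rw [e, starGraph_adj, hn, hn, φ.injective.ne_iff]

/-! ### Sliding a branch along an edge -/

open Classical in
/-- The weighted graph obtained by replacing the edge `s(v, c)` with an edge `s(a, c)` of the same
weight. If `v` is adjacent to `a` in a tree, this slides the branch of `c` along the edge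
`s(v, a)`. -/
@[reducible]
def slide (G : WeightedGraph) {v a c : G.V} (hvc : G.graph.Adj v c) (hac : a ≠ c) :
    WeightedGraph where
  V := G.V
  graph := G.graph.deleteEdges {s(v, c)} ⊔ edge a c
  weight e := if e = s(a, c) then G.weight s(v, c) else if e = s(v, c) then 0 else G.weight e
  weight_pos := by
    intro e he
    split_ifs with h1 h2
    · exact G.weight_pos_of_adj hvc
    · subst h2
      simp [edgeSet_edge_of_ne hac, h1] at he
    · refine G.weight_pos e ?_
      simp [edgeSet_edge_of_ne hac, h1] at he
      exact he.1
  weight_zero := by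
    intro e he
    simp only [edgeSet_sup, edgeSet_deleteEdges, edgeSet_edge_of_ne hac, Set.mem_union,
      Set.mem_sdiff, Set.mem_singleton_iff, not_or, not_and, not_not] at he
    rw [if_neg he.2]
    split_ifs with h
    · rfl
    · exact G.weight_zero e fun h' => h (he.1 h')

variable {v a c : G.V}

lemma slide_adj (hvc : G.graph.Adj v c) (hac : a ≠ c) {x y : G.V} :
    (G.slide hvc hac).graph.Adj x y ↔
    (G.graph.Adj x y ∧ s(x, y) ≠ s(v, c)) ∨ s(x, y) = s(a, c) := by
  rw [← mem_edgeSet]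
  simp [edgeSet_edge_of_ne hac, or_comm]

lemma notMem_cutSide_of_adj_of_adj (hG : G.graph.IsTree) (hva : G.graph.Adj v a)
    (hvc : G.graph.Adj v c) (hac : a ≠ c) : c ∉ G.graph.cutSide s(v, c) a := by
  rw [cutSide_eq_of_adj hva (by simpa [Sym2.eq_iff, hva.ne'] using hac)]
  exact hG.isAcyclic.notMem_cutSide hvc

lemma not_adj_of_adj_of_adj (hG : G.graph.IsTree) (hva : G.graph.Adj v a)
    (hvc : G.graph.Adj v c) (hac : a ≠ c) : ¬ G.graph.Adj a c := fun h =>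
  notMem_cutSide_of_adj_of_adj hG hva hvc hac
    (mem_cutSide_of_adj h (by simp [hva.ne', hac]))

open Classical in
lemma edgeFinset_slide (hvc : G.graph.Adj v c) (hac : a ≠ c)
    [Fintype (G.slide hvc hac).graph.edgeSet] : (G.slide hvc hac).graph.edgeFinset =
    insert s(a, c) (G.graph.edgeFinset.erase s(v, c)) := by
  ext e
  induction e using Sym2.ind with
  | _ x y =>
    rw [mem_edgeFinset, mem_edgeSet, slide_adj]
    simp only [Finset.mem_insert, Finset.mem_erase, mem_edgeFinset, mem_edgeSet]
    tauto

lemma isTree_slide (hG : G.graph.IsTree) (hva : G.graph.Adj v a)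
    (hvc : G.graph.Adj v c) (hac : a ≠ c) : (G.slide hvc hac).graph.IsTree := by
  classical
  have hle : G.graph.deleteEdges {s(v, c)} ≤ (G.slide hvc hac).graph := le_sup_left
  have h1 : (G.slide hvc hac).graph.Adj v a :=
    slide_adj hvc hac |>.2 (Or.inl ⟨hva, by simpa [Sym2.eq_iff, hvc.ne] using hac⟩)
  have h2 : (G.slide hvc hac).graph.Adj a c := slide_adj hvc hac |>.2 (Or.inr rfl)
  have hreach : ∀ x : G.V, (G.slide hvc hac).graph.Reachable x v := by
    intro x
    rcases hG.connected.mem_cutSide_or (a := v) (b := c) x with hx | hx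
    · exact ((mem_cutSide.1 hx).mono hle).symm
    · exact (((mem_cutSide.1 hx).mono hle).symm.trans h2.symm.reachable).trans h1.symm.reachable
  have hconn : (G.slide hvc hac).graph.Connected :=
    ⟨fun x y => (hreach x).trans (hreach y).symm⟩
  rw [isTree_iff_connected_and_card]
  refine ⟨hconn, ?_⟩
  have h3 := (isTree_iff_connected_and_card.1 hG).2
  rw [Nat.card_eq_fintype_card, ← edgeFinset_card] at h3 ⊢
  rw [edgeFinset_slide, Finset.card_insert_of_notMem, Finset.card_erase_add_one]
  · exact h3
  · exact mem_edgeFinset.2 hvc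
  · simp [not_adj_of_adj_of_adj hG hva hvc hac]

lemma edgeWeights_slide (hG : G.graph.IsTree) (hva : G.graph.Adj v a)
    (hvc : G.graph.Adj v c) (hac : a ≠ c) : (G.slide hvc hac).edgeWeights = G.edgeWeights := by
  classical
  have hne : s(v, c) ≠ s(a, c) := fun h => hva.ne (Sym2.congr_left.1 h)
  rw [edgeWeights, edgeWeights, edgeFinset_slide,
    ← Finset.insert_erase (mem_edgeFinset.2 hvc : s(v, c) ∈ G.graph.edgeFinset),
    Finset.erase_insert (Finset.notMem_erase _ _),
    Finset.insert_val_of_notMem (by simp [not_adj_of_adj_of_adj hG hva hvc hac]),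
    Finset.insert_val_of_notMem (Finset.notMem_erase _ _), Multiset.map_cons, Multiset.map_cons]
  congr 1
  · simp
  · refine Multiset.map_congr rfl fun e he => ?_
    have he' := Finset.mem_erase.1 (Finset.mem_def.2 he)
    have : e ≠ s(a, c) := by
      rintro rfl
      exact not_adj_of_adj_of_adj hG hva hvc hac (mem_edgeFinset.1 he'.2)
    simp [this, he'.1]

open Classical in
lemma sum_ite_edge {V : Type*} [Fintype V] {p q : V} (hpq : p ≠ q) (x : V) (t : ℝ) :
    (∑ y, if s(x, y) = s(p, q) then t else 0) =
      (if x = p then t else 0) + if x = q then t else 0 := by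
  by_cases hp : x = p
  · subst hp
    simp [hpq]
  · by_cases hq : x = q
    · subst hq
      simp [Sym2.eq_swap (a := p), hp]
    · simp [hp, hq]

open Classical in
lemma degree_slide (hG : G.graph.IsTree) (hva : G.graph.Adj v a)
    (hvc : G.graph.Adj v c) (hac : a ≠ c) (x : G.V) : (G.slide hvc hac).degree x = G.degree x +
    (if x = a then G.weight s(v, c) else 0) - if x = v then G.weight s(v, c) else 0 := by
  have hw : ∀ e, (G.slide hvc hac).weight e = G.weight e +
      (if e = s(a, c) then G.weight s(v, c) else 0) -
        if e = s(v, c) then G.weight s(v, c) else 0 := by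
    intro e
    have hne : s(a, c) ≠ s(v, c) := fun h => hva.ne' (Sym2.congr_left.1 h)
    by_cases h1 : e = s(a, c)
    · subst h1
      simp [hne, G.weight_of_not_adj (not_adj_of_adj_of_adj hG hva hvc hac)]
    · by_cases h2 : e = s(v, c)
      · subst h2
        simp [hne.symm]
      · simp [h1, h2]
  rw [degree, Finset.sum_congr rfl fun y _ => hw s(x, y)]
  rw [Finset.sum_sub_distrib, Finset.sum_add_distrib, sum_ite_edge hac, sum_ite_edge hvc.ne, degree]
  ring

open Classical in
lemma sum_degree_slide (hG : G.graph.IsTree) (hva : G.graph.Adj v a)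
    (hvc : G.graph.Adj v c) (hac : a ≠ c) (S : Finset G.V) : ∑ x ∈ S, (G.slide hvc hac).degree x =
    ∑ x ∈ S, G.degree x + (if a ∈ S then G.weight s(v, c) else 0) -
      if v ∈ S then G.weight s(v, c) else 0 := by
  simp_rw [degree_slide hG hva hvc hac]
  rw [Finset.sum_sub_distrib, Finset.sum_add_distrib]
  simp

/-- Sliding along `s(v, a)` does not affect the sides of the other edges. -/
lemma cutSide_slide (hG : G.graph.IsTree) (hva : G.graph.Adj v a)
    (hvc : G.graph.Adj v c) (hac : a ≠ c) {p q : G.V} (hpq : G.graph.Adj p q)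
    (h1 : s(v, a) ≠ s(p, q))
    (h2 : s(v, c) ≠ s(p, q)) :
    (G.slide hvc hac).graph.cutSide s(p, q) p = G.graph.cutSide s(p, q) p := by
  refine (isTree_slide hG hva hvc hac).connected.cutSide_eq (self_mem_cutSide _ _)
    (hG.isAcyclic.notMem_cutSide hpq) fun (u w : G.V) huw hne hu => ?_
  have hside : G.graph.cutSide s(p, q) a = G.graph.cutSide s(p, q) c := by
    rw [cutSide_eq_of_adj hva h1, cutSide_eq_of_adj hvc h2]
  rw [mem_cutSide_comm] at hu ⊢
  rcases (slide_adj hvc hac).1 huw with ⟨h, -⟩ | h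
  · rwa [cutSide_eq_of_adj h hne]
  · rcases Sym2.eq_iff.1 h with ⟨e1, e2⟩ | ⟨e1, e2⟩
    · rw [e1] at hu
      rwa [e2, ← hside]
    · rw [e1] at hu
      rwa [e2, hside]

/-- The edge `s(a, c)` plays the role of the edge `s(v, c)` that it replaces. -/
lemma cutSide_slide_new (hG : G.graph.IsTree) (hva : G.graph.Adj v a)
    (hvc : G.graph.Adj v c) (hac : a ≠ c) :
    (G.slide hvc hac).graph.cutSide s(a, c) a = G.graph.cutSide s(v, c) v := by
  have ha : a ∈ G.graph.cutSide s(v, c) v :=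
    mem_cutSide_of_adj hva (by simpa [Sym2.eq_iff, hva.ne'] using hac)
  refine (isTree_slide hG hva hvc hac).connected.cutSide_eq ha
    (hG.isAcyclic.notMem_cutSide hvc) fun (u w : G.V) huw hne hu => ?_
  rcases (slide_adj hvc hac).1 huw with ⟨h, h'⟩ | h
  · rw [mem_cutSide_comm] at hu ⊢
    rwa [cutSide_eq_of_adj h h']
  · exact absurd h hne

open Classical in
/-- The branch of `c` moves from the side of `v` to the side of `a`. -/
lemma cutSide_slide_along (hG : G.graph.IsTree) (hva : G.graph.Adj v a)
    (hvc : G.graph.Adj v c) (hac : a ≠ c) : (G.slide hvc hac).graph.cutSide s(v, a) v =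
    G.graph.cutSide s(v, a) v \ G.graph.cutSide s(v, c) c := by
  have hc : ∀ x, x ∈ G.graph.cutSide s(v, c) c ↔ x ∉ G.graph.cutSide s(v, c) v :=
    hG.mem_cutSide_iff hvc
  refine (isTree_slide hG hva hvc hac).connected.cutSide_eq ?_ ?_ fun (u w : G.V) huw hne hu => ?_
  · simp [hc, self_mem_cutSide]
  · simp [hG.isAcyclic.notMem_cutSide hva]
  · rw [Finset.mem_sdiff] at hu ⊢
    rcases (slide_adj hvc hac).1 huw with ⟨h, h'⟩ | h
    · rw [mem_cutSide_comm, mem_cutSide_comm (y := w)]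
      rw [mem_cutSide_comm, mem_cutSide_comm (y := u)] at hu
      rwa [cutSide_eq_of_adj h h', cutSide_eq_of_adj h hne]
    · rcases Sym2.eq_iff.1 h with ⟨e, -⟩ | ⟨e, -⟩
      · rw [e] at hu
        exact absurd hu.1 (hG.isAcyclic.notMem_cutSide hva)
      · rw [e] at hu
        exact absurd (self_mem_cutSide _ _) hu.2

/-- The branch of `c` at `v` lies on the side of `v` of any other edge `s(v, a)`. -/
lemma cutSide_subset (hG : G.graph.IsTree) (hva : G.graph.Adj v a)
    (hvc : G.graph.Adj v c) (hac : a ≠ c) :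
    G.graph.cutSide s(v, c) c ⊆ G.graph.cutSide s(v, a) v := by
  intro x hx
  have hxc := (hG.mem_cutSide_iff hvc x).1 hx
  by_contra hxa
  have hne : v ≠ x := fun h => hxc (h ▸ self_mem_cutSide _ _)
  exact hac ((hG.existsUnique_notMem_cutSide hne).unique ⟨hva, hxa⟩ ⟨hvc, hxc⟩)

/-- If `v` has neighbours `a`, `b`, `c`, and the branch of `a` is at most as heavy as that of `b`,
then sliding the branch of `c` along `s(v, a)` increases `cutSum`: only the term of `s(v, a)`
changes, and its two factors, whose sum is fixed, come closer to each other. -/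
lemma cutSum_lt_cutSum_slide (hG : G.graph.IsTree) (hva : G.graph.Adj v a)
    (hvc : G.graph.Adj v c) (hac : a ≠ c) {b : G.V}
    (hvb : G.graph.Adj v b) (hab : a ≠ b) (hbc : b ≠ c)
    (hle : G.cutDegree s(v, a) a ≤ G.cutDegree s(v, b) b) :
    G.cutSum v < (G.slide hvc hac).cutSum v := by
  classical
  have hT := isTree_slide hG hva hvc hac
  have htot : (G.slide hvc hac).totalDegree = G.totalDegree := by
    rw [totalDegree_eq, totalDegree_eq, edgeWeights_slide hG hva hvc hac]
  have hva_ne : s(v, a) ≠ s(v, c) := by simpa [Sym2.eq_iff, hvc.ne] using hac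
  have hE : s(v, c) ∈ G.graph.edgeFinset := mem_edgeFinset.2 hvc
  have hE' : s(v, a) ∈ G.graph.edgeFinset.erase s(v, c) :=
    Finset.mem_erase.2 ⟨hva_ne, mem_edgeFinset.2 hva⟩
  have hnew : s(a, c) ∉ G.graph.edgeFinset := by
    simp [not_adj_of_adj_of_adj hG hva hvc hac]
  have hadj : ∀ {e}, e ∈ G.graph.edgeFinset.erase s(v, c) →
      (G.slide hvc hac).weight e = G.weight e := by
    intro e he
    have he' := Finset.mem_erase.1 he
    have : e ≠ s(a, c) := fun h => hnew (h ▸ he'.2)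
    simp [this, he'.1]
  rw [cutSum, cutSum, edgeFinset_slide, Finset.sum_insert (fun h => hnew (Finset.mem_erase.1 h).2),
    ← Finset.add_sum_erase _ _ hE, ← Finset.add_sum_erase _ _ hE', ← Finset.add_sum_erase _ _ hE',
    htot]
  have ha_mem : a ∈ G.graph.cutSide s(v, c) v := mem_cutSide_of_adj hva hva_ne
  have term_vc : (G.slide hvc hac).cutDegree s(a, c) v = G.cutDegree s(v, c) v := by
    have hv : v ∈ (G.slide hvc hac).graph.cutSide s(a, c) a := by
      rw [cutSide_slide_new hG hva]
      exact self_mem_cutSide _ _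
    rw [cutDegree_eq_of_mem hv, cutDegree, cutSide_slide_new hG hva,
      sum_degree_slide hG hva hvc hac, if_pos ha_mem, if_pos (self_mem_cutSide _ _),
      add_sub_cancel_right, cutDegree]
  have weight_vc : (G.slide hvc hac).weight s(a, c) = G.weight s(v, c) := if_pos rfl
  have rest : ∀ e ∈ (G.graph.edgeFinset.erase s(v, c)).erase s(v, a),
      (G.slide hvc hac).cutDegree e v * (G.totalDegree - (G.slide hvc hac).cutDegree e v) /
        (G.slide hvc hac).weight e =
      G.cutDegree e v * (G.totalDegree - G.cutDegree e v) / G.weight e := by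
    intro e he
    have he1 := Finset.mem_erase.1 he
    have he2 := Finset.mem_erase.1 he1.2
    rw [hadj he1.2]
    congr 1
    induction e using Sym2.ind with
    | _ p q =>
      have hpq : G.graph.Adj p q := mem_edgeFinset.1 he2.2
      have hpq' : (G.slide hvc hac).graph.Adj p q := (slide_adj hvc hac).2 (Or.inl ⟨hpq, he2.1⟩)
      have same : ∀ {p q : G.V}, G.graph.Adj p q → s(v, a) ≠ s(p, q) → s(v, c) ≠ s(p, q) →
          (G.slide hvc hac).cutDegree s(p, q) p = G.cutDegree s(p, q) p := by
        intro p q hpq h1 h2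
        have hav : a ∈ G.graph.cutSide s(p, q) p ↔ v ∈ G.graph.cutSide s(p, q) p := by
          rw [mem_cutSide_comm, mem_cutSide_comm (y := v), cutSide_eq_of_adj hva h1]
        rw [cutDegree, cutSide_slide hG hva hvc hac hpq h1 h2, sum_degree_slide hG hva hvc hac,
          cutDegree]
        simp [hav]
      have hq := same hpq.symm (Sym2.eq_swap (a := p) ▸ he1.1.symm)
        (Sym2.eq_swap (a := p) ▸ he2.1.symm)
      rw [Sym2.eq_swap] at hq
      rw [cutDegree_mul_sub hG hpq, ← htot, cutDegree_mul_sub hT hpq',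
        same hpq he1.1.symm he2.1.symm, hq]
  rw [term_vc, weight_vc, Finset.sum_congr rfl rest, hadj hE', add_lt_add_iff_left,
    add_lt_add_iff_right]
  refine div_lt_div_of_pos_right ?_ (G.weight_pos_of_adj hva)
  have along : (G.slide hvc hac).cutDegree s(v, a) v =
      G.cutDegree s(v, a) v - (G.weight s(v, c) + G.cutDegree s(v, c) c) := by
    have hv : v ∉ G.graph.cutSide s(v, c) c := fun h =>
      (hG.mem_cutSide_iff hvc v).1 h (self_mem_cutSide _ _)
    rw [cutDegree, cutSide_slide_along hG hva, sum_degree_slide hG hva hvc hac,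
      if_neg (by simp [hG.isAcyclic.notMem_cutSide hva]),
      if_pos (by simp [hv, self_mem_cutSide]), Finset.sum_sdiff_eq_sub
        (cutSide_subset hG hva hvc hac), cutDegree, cutDegree]
    ring
  have hsplit := cutDegree_add hG hva
  have hbranch := degree_add_sum_cutDegree hG v
  have hthree : G.cutDegree s(v, a) a + (G.cutDegree s(v, b) b + G.cutDegree s(v, c) c) ≤
      ∑ w with G.graph.Adj v w, G.cutDegree s(v, w) w := by
    rw [← Finset.sum_pair (f := fun w => G.cutDegree s(v, w) w) hbc,
      ← Finset.sum_insert (f := fun w => G.cutDegree s(v, w) w) (by simp [hab, hac])]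
    refine Finset.sum_le_sum_of_subset_of_nonneg ?_ fun _ _ _ => cutDegree_nonneg _ _
    intro w
    simp only [Finset.mem_insert, Finset.mem_singleton, Finset.mem_filter, Finset.mem_univ,
      true_and]
    rintro (rfl | rfl | rfl) <;> assumption
  have hdeg : G.weight s(v, a) + G.weight s(v, c) ≤ G.degree v := by
    rw [← Finset.sum_pair (f := fun w => G.weight s(v, w)) hac]
    exact Finset.sum_le_sum_of_subset_of_nonneg (Finset.subset_univ _)
      fun _ _ _ => G.weight_nonneg _
  have h1 := G.weight_pos_of_adj hva
  have h2 := G.weight_pos_of_adj hvc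
  have h3 := cutDegree_nonneg s(v, c) c
  rw [along]
  set δ := G.weight s(v, c) + G.cutDegree s(v, c) c with hδ
  have hδ0 : 0 < δ := by positivity
  have hgap : 0 < G.cutDegree s(v, a) v - δ - G.cutDegree s(v, a) a := by linarith
  rw [← hsplit]
  nlinarith [mul_pos hδ0 hgap]

/-! ### Maximizers are paths -/

/-- A maximizer has no vertex with three neighbours: of the branches of two neighbours `a` and
`b`, one is at most as heavy as the other, and a third branch can be slid towards it. -/
theorem isPath_of_isMaxOn {T : WeightedGraph} (hT : T ∈ trees W)
    (hmax : IsMaxOn kemeny (trees W) T) : T.IsPath := by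
  refine hT.1.exists_iso_pathGraph fun v a b c hva hvb hvc => ?_
  by_contra! hne
  have key : ∀ {a b : T.V} (hva : T.graph.Adj v a) (hvb : T.graph.Adj v b) (hab : a ≠ b)
      (hac : a ≠ c) (hbc : b ≠ c), ¬ T.cutDegree s(v, a) a ≤ T.cutDegree s(v, b) b := by
    intro a b hva hvb hab hac hbc hle
    have hmem : T.slide hvc hac ∈ trees W :=
      ⟨isTree_slide hT.1 hva hvc hac, (edgeWeights_slide hT.1 hva hvc hac).trans hT.2⟩
    exact ((kemeny_le_kemeny_iff hmem hT v v).1 (hmax hmem)).not_gt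
      (cutSum_lt_cutSum_slide hT.1 hva hvc hac hvb hab hbc hle)
  rcases le_total (T.cutDegree s(v, a) a) (T.cutDegree s(v, b) b) with h | h
  · exact key hva hvb hne.1 hne.2.1 hne.2.2 h
  · exact key hvb hva hne.1.symm hne.2.2 hne.2.1 h

/-! ### Existence of a maximizer -/

lemma weight_mem (hG : G ∈ trees W) (e : Sym2 G.V) : G.weight e ∈ insert 0 {w | w ∈ W} := by
  classical
  by_cases h : e ∈ G.graph.edgeSet
  · right
    change _ ∈ W
    rw [← hG.2]
    exact Multiset.mem_map_of_mem _ (mem_edgeFinset.2 h)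
  · exact Or.inl (G.weight_zero e h)

/-- There are only finitely many trees with given edge weights up to isomorphism; what is needed
here is that `cutSum` takes only finitely many values on them. -/
lemma finite_cutSum (W : Multiset ℝ) :
    ((fun T : WeightedGraph => T.cutSum (Classical.arbitrary T.V)) '' trees W).Finite := by
  classical
  have hF : (insert 0 {w | w ∈ W}).Finite := W.finite_toSet.insert 0
  -- the possible values of `cutDegree`, as sums of one number for each pair of vertices
  set D := {x : ℝ | ∃ m : Multiset ℝ, (∀ a ∈ m, a ∈ insert 0 {w | w ∈ W}) ∧
    m.card = (W.card + 1) * (W.card + 1) ∧ m.sum = x} with hD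
  have hDfin : D.Finite := Multiset.finite_sums _ hF _
  have hQ := Set.Finite.image2 (fun d w : ℝ => d * (2 * W.sum - d) / w) hDfin hF
  refine (Multiset.finite_sums _ hQ W.card).subset ?_
  rintro _ ⟨T, hT, rfl⟩
  have hcard : T.graph.edgeFinset.card = W.card := by
    conv_rhs => rw [← hT.2, edgeWeights, Multiset.card_map]
    rfl
  have hV : Fintype.card T.V = W.card + 1 := by
    rw [← hcard, hT.1.card_edgeFinset]
  refine ⟨_, ?_, (Multiset.card_map _ _).trans hcard, rfl⟩
  intro q hq
  obtain ⟨e, -, rfl⟩ := Multiset.mem_map.1 hq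
  refine ⟨_, ⟨(Finset.univ : Finset (T.V × T.V)).val.map fun p =>
    if p.1 ∈ T.graph.cutSide e (Classical.arbitrary T.V) then T.weight s(p.1, p.2) else 0,
    ?_, ?_, rfl⟩, _, weight_mem hT e, ?_⟩
  · intro x hx
    obtain ⟨p, -, rfl⟩ := Multiset.mem_map.1 hx
    split_ifs
    · exact weight_mem hT _
    · exact Or.inl rfl
  · rw [Multiset.card_map, ← Finset.card_def, Finset.card_univ, Fintype.card_prod, hV]
  · have : T.cutDegree e (Classical.arbitrary T.V) =
        ((Finset.univ : Finset (T.V × T.V)).val.map fun p =>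
          if p.1 ∈ T.graph.cutSide e (Classical.arbitrary T.V) then
            T.weight s(p.1, p.2) else 0).sum := by
      rw [← Finset.sum_eq_multiset_sum, Fintype.sum_prod_type, cutDegree,
        ← Finset.sum_subset (Finset.subset_univ (T.graph.cutSide e (Classical.arbitrary T.V)))
          fun x _ hx => Finset.sum_eq_zero fun y _ => if_neg hx]
      exact Finset.sum_congr rfl fun x hx => Finset.sum_congr rfl fun y _ => (if_pos hx).symm
    rw [totalDegree_of_mem_trees hT, this]

theorem exists_isMaxOn_kemeny (hW : ∀ w ∈ W, 0 < w) :
    ∃ T ∈ trees W, IsMaxOn kemeny (trees W) T := by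
  obtain ⟨_, ⟨T, hT, rfl⟩, hmax⟩ := Set.exists_max_image _ id (finite_cutSum W)
    (Set.Nonempty.image _ ⟨_, star_mem_trees hW⟩)
  exact ⟨T, hT, fun T' hT' => (kemeny_le_kemeny_iff hT' hT (Classical.arbitrary T'.V)
    (Classical.arbitrary T.V)).2 (hmax _ ⟨T', hT', rfl⟩)⟩

end WeightedGraph

end

theorem theorem3 (W : Multiset ℝ) (hW : ∀ w ∈ W, 0 < w) :
    -- Kemeny's constant is well defined and finite on the trees with edge weights `W`
    (∀ T ∈ WeightedGraph.trees W,
      (∃! π : T.V → ℝ, T.IsStationary π) ∧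
      (∀ u : T.V, T.kemenyFrom u = T.kemeny) ∧
      T.kemeny ≠ ⊤) ∧
    -- it has maximizers, and every maximizer is a weighted path
    (∃ T ∈ WeightedGraph.trees W, IsMaxOn WeightedGraph.kemeny (WeightedGraph.trees W) T) ∧
    (∀ T ∈ WeightedGraph.trees W,
      IsMaxOn WeightedGraph.kemeny (WeightedGraph.trees W) T → T.IsPath) ∧
    -- the weighted star is its minimizer, unique up to isomorphism
    WeightedGraph.star W hW ∈ WeightedGraph.trees W ∧
    (∀ T ∈ WeightedGraph.trees W,
      IsMinOn WeightedGraph.kemeny (WeightedGraph.trees W) T ↔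
        T.Isomorphic (WeightedGraph.star W hW)) := by
  refine ⟨fun T hT => ⟨WeightedGraph.existsUnique_isStationary hT.1, fun u => ?_, ?_⟩,
    WeightedGraph.exists_isMaxOn_kemeny hW, fun T hT => WeightedGraph.isPath_of_isMaxOn hT,
    WeightedGraph.star_mem_trees hW, fun T hT => WeightedGraph.isMinOn_kemeny_iff hW hT⟩
  · rw [WeightedGraph.kemeny, WeightedGraph.kemenyFrom_eq hT.1 _ u,
      WeightedGraph.kemenyFrom_eq hT.1 _ u]
  · rw [WeightedGraph.kemeny, WeightedGraph.kemenyFrom_eq hT.1 _ (Classical.arbitrary T.V)]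
    exact ENNReal.ofReal_ne_top
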